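/- Let $\mathsf{M}$ be a matroid on a finite ground set and, for each integer $k\geq 0$, let $I_k(\mathsf{M})$ denote the number of independent sets of $\mathsf{M}$ of cardinality $k$. Then the sequence $I_0(\mathsf{M}), I_1(\mathsf{M}), I_2(\mathsf{M}),\ldots$ is log-concave, i.e., it is a sequence of non-negative numbers without internal zeros (if $i<k<j$ and $I_i(\mathsf{M})\neq 0$ and $I_j(\mathsf{M})\neq 0$, then $I_k(\mathsf{M})\neq 0$), and $$I_k(\mathsf{M})^2\;\geq\; I_{k-1}(\mathsf{M})\cdot I_{k+1}(\mathsf{M})\qquad\text{for all } k\geq 1.$$ -/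

import Mathlib

/-- A sequence `a 0, a 1, a 2, …` of real numbers is *log-concave* if its terms are non-negative,
it has no internal zeros, and `a k ^ 2 ≥ a (k - 1) * a (k + 1)` for every `k ≥ 1`
(written with `k + 1` in place of `k`). -/
structure IsLogConcaveSeq (a : ℕ → ℝ) : Prop where
  nonneg : ∀ k, 0 ≤ a k
  no_internal_zeros : ∀ i j k, i < k → k < j → a i ≠ 0 → a j ≠ 0 → a k ≠ 0
  mul_le_sq : ∀ k, a k * a (k + 2) ≤ a (k + 1) ^ 2

/-- The number of independent sets of cardinality `k` of a matroid on a finite ground set. -/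
noncomputable def Matroid.numIndep {α : Type*} (M : Matroid α) (k : ℕ) : ℕ :=
  {I : Set α | M.Indep I ∧ I.ncard = k}.ncard

/-! Weigh walks on multisets whose steps add one element (weight 1) or nothing (`none`, weight t >
0), and let `levelSum` n m be the weight of the n-step walks from m that end in an independent set.
For fixed m, its values after two further steps x, y form a symmetric matrix; `levelSum_form_le_sq`
shows by induction on n that this matrix satisfies a reverse Cauchy-Schwarz inequality at the weight
vector. For n = 0 the form is a square minus a sum of squares, one per parallel class. In the
induction it is an average of forms of the previous level, and the spectral argument of
`form_nonpos_of_le_sum_sq_div` passes the inequality on. Testing against `none` gives log-concavity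
in n. As t → 0 the walks from 0 number n! times the independent n-sets, so the factorials even yield
(k+2) I_k I_{k+2} ≤ (k+1) I_{k+1}². -/

/-! ### Forms with at most one positive direction -/

/-- A real quadratic form is nonpositive on a vector that is orthogonal to all eigenvectors
with positive eigenvalue. -/
theorem Matrix.IsHermitian.dotProduct_mulVec_nonpos {ι : Type*} [Fintype ι] [DecidableEq ι]
    {A : Matrix ι ι ℝ} (hA : A.IsHermitian) (y : ι → ℝ)
    (hy : ∀ (v : ι → ℝ) (c : ℝ), 0 < c → A.mulVec v = c • v → ∑ i, y i * v i = 0) :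
    ∑ i, y i * A.mulVec y i ≤ 0 := by
  have hsymm (v : ι → ℝ) : ∑ i, v i * A.mulVec y i = ∑ i, A.mulVec v i * y i := by
    change v ⬝ᵥ A.mulVec y = A.mulVec v ⬝ᵥ y
    rw [Matrix.dotProduct_mulVec, ← Matrix.mulVec_transpose]
    rw [← Matrix.conjTranspose_eq_transpose_of_trivial, hA.eq]
  have key := hA.eigenvectorBasis.sum_inner_mul_inner (WithLp.toLp 2 y)
    (WithLp.toLp 2 (A.mulVec y))
  have h1 (x z : EuclideanSpace ℝ ι) : inner ℝ x z = ∑ i, x i * z i := by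
    simp [PiLp.inner_apply, mul_comm]
  have h2 : ∑ i, y i * A.mulVec y i = inner ℝ (WithLp.toLp 2 y) (WithLp.toLp 2 (A.mulVec y)) := by
    rw [h1]
  rw [h2, ← key]
  refine Finset.sum_nonpos fun k _ => ?_
  have hk := hA.mulVec_eigenvectorBasis k
  rw [h1, h1]
  simp only [hsymm, hk, Pi.smul_apply, smul_eq_mul]
  rcases lt_or_ge 0 (hA.eigenvalues k) with hpos | hneg
  · rw [hy _ _ hpos hk, zero_mul]
  · have : ∑ i, hA.eigenvalues k * hA.eigenvectorBasis k i * y i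
        = hA.eigenvalues k * ∑ i, y i * hA.eigenvectorBasis k i := by
      rw [Finset.mul_sum]; exact Finset.sum_congr rfl fun i _ => by ring
    rw [this]
    nlinarith [mul_nonneg (neg_nonneg.2 hneg) (sq_nonneg (∑ i, y i * hA.eigenvectorBasis k i))]

section Form

variable {ι : Type*} [Fintype ι]

theorem sum_sum_mul_comm_of_symm {B : ι → ι → ℝ} (hB : ∀ i j, B i j = B j i) (x y : ι → ℝ) :
    ∑ i, x i * ∑ j, B i j * y j = ∑ i, y i * ∑ j, B i j * x j := by
  simp only [Finset.mul_sum]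
  rw [Finset.sum_comm]
  exact Finset.sum_congr rfl fun i _ => Finset.sum_congr rfl fun j _ => by rw [hB]; ring

/-- If a symmetric bilinear form is nonpositive on a hyperplane not containing `w` and is
nonnegative at `w`, then the reverse Cauchy-Schwarz inequality holds at `w`. -/
theorem reverse_cauchySchwarz_of_nonpos_on_hyperplane {B : ι → ι → ℝ}
    (hB : ∀ i j, B i j = B j i) (w l : ι → ℝ) (hl : ∑ i, l i * w i ≠ 0)
    (hw : 0 ≤ ∑ i, w i * ∑ j, B i j * w j)
    (h : ∀ x : ι → ℝ, ∑ i, l i * x i = 0 → ∑ i, x i * ∑ j, B i j * x j ≤ 0) (u : ι → ℝ) :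
    (∑ i, u i * ∑ j, B i j * u j) * (∑ i, w i * ∑ j, B i j * w j)
      ≤ (∑ i, u i * ∑ j, B i j * w j) ^ 2 := by
  set p := ∑ i, l i * w i
  set q := ∑ i, l i * u i
  -- This combination is the one killed by `l`; expanding the form on it and completing the square
  -- gives the claim.
  have hx := h (fun i => p * u i - q * w i) (by
    simp only [mul_sub, Finset.sum_sub_distrib, mul_left_comm (l _), ← Finset.mul_sum]
    change p * q - q * p = 0
    ring)
  have hc := sum_sum_mul_comm_of_symm hB w u
  set b := ∑ i, u i * ∑ j, B i j * w j
  set a := ∑ i, u i * ∑ j, B i j * u j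
  set d := ∑ i, w i * ∑ j, B i j * w j
  have hexp : ∑ i, (p * u i - q * w i) * ∑ j, B i j * (p * u j - q * w j)
      = p ^ 2 * a - 2 * p * q * b + q ^ 2 * d := by
    simp only [mul_sub, sub_mul, Finset.sum_sub_distrib, mul_left_comm (B _ _),
      ← Finset.mul_sum, mul_assoc, mul_left_comm (u _), mul_left_comm (w _)]
    rw [hc]
    change p * (p * a) - q * (p * b) - (p * (q * b) - q * (q * d)) = _
    ring
  rw [hexp] at hx
  have hp : 0 < p ^ 2 := by positivity
  have : p ^ 2 * (a * d - b ^ 2) ≤ 0 := by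
    nlinarith [mul_nonneg (neg_nonneg.2 hx) hw, sq_nonneg (q * d - p * b)]
  nlinarith [nonpos_of_mul_nonpos_right this hp]

/-- A nonnegative symmetric form `B` with a positive vector `w` such that
`B(u,u) ≤ ∑ wᵢ (B u)ᵢ² / (B w)ᵢ` is nonpositive on the orthogonal complement of `w`, provided
that some index `o` is joined to each index whose row is nonzero. -/
theorem form_nonpos_of_le_sum_sq_div {B : ι → ι → ℝ} (hB : ∀ i j, B i j = B j i)
    (hB0 : ∀ i j, 0 ≤ B i j) (w r : ι → ℝ) (hw : ∀ i, 0 < w i)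
    (hr : ∀ i, r i = ∑ j, B i j * w j) (o : ι) (ho : ∀ i, r i ≠ 0 → B o i ≠ 0)
    (h : ∀ u : ι → ℝ, ∑ i, u i * ∑ j, B i j * u j ≤ ∑ i, w i * (∑ j, B i j * u j) ^ 2 / r i)
    (x : ι → ℝ) (hx : ∑ i, r i * x i = 0) :
    ∑ i, x i * ∑ j, B i j * x j ≤ 0 := by
  classical
  have hr0 i : 0 ≤ r i := by
    rw [hr]; exact Finset.sum_nonneg fun j _ => mul_nonneg (hB0 i j) (hw j).le
  set s : ι → ℝ := fun i => √(w i / r i) with hs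
  set p : ι → ℝ := fun i => √(r i / w i) with hp
  have hs2 i : s i ^ 2 = w i / r i := Real.sq_sqrt (div_nonneg (hw i).le (hr0 i))
  have hp2 i : p i ^ 2 = r i / w i := Real.sq_sqrt (div_nonneg (hr0 i) (hw i).le)
  have hsp i (hi : r i ≠ 0) : s i * p i = 1 := by
    rw [hs, hp]
    simp only
    rw [← Real.sqrt_mul (div_nonneg (hw i).le (hr0 i))]
    have := (hw i).ne'
    rw [show w i / r i * (r i / w i) = 1 by field_simp, Real.sqrt_one]
  have hs0 i (hi : r i = 0) : s i = 0 := by simp [hs, hi]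
  have hp0 i (hi : r i = 0) : p i = 0 := by simp [hp, hi]
  have hBr i (hi : r i = 0) j : B i j = 0 := by
    rw [hr, Finset.sum_eq_zero_iff_of_nonneg
      fun j _ => mul_nonneg (hB0 i j) (hw j).le] at hi
    exact (mul_eq_zero.1 (hi j (Finset.mem_univ j))).resolve_right (hw j).ne'
  -- In this scaling `h` bounds the form of A by that of A², so a positive eigenvalue is at least 1.
  let A : Matrix ι ι ℝ := fun i j => s i * B i j * s j
  have hA : A.IsHermitian := by
    refine Matrix.IsHermitian.ext fun i j => ?_
    simp only [star_trivial, A, hB j i]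
    ring
  have hAv (v : ι → ℝ) i : A.mulVec v i = s i * ∑ j, B i j * (s j * v j) := by
    simp only [Matrix.mulVec, dotProduct, A, Finset.mul_sum, mul_assoc]
  have main := hA.dotProduct_mulVec_nonpos (fun i => x i * p i) ?_
  · convert main using 1
    refine Finset.sum_congr rfl fun i _ => ?_
    rw [hAv]
    by_cases hi : r i = 0
    · simp [hBr i hi]
    have : ∑ j, B i j * (s j * (x j * p j)) = ∑ j, B i j * x j := by
      refine Finset.sum_congr rfl fun j _ => ?_
      by_cases hj : r j = 0
      · simp [hB i j, hBr j hj]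
      · linear_combination B i j * x j * hsp j hj
    rw [this]
    linear_combination - x i * (∑ j, B i j * x j) * hsp i hi
  intro v c hc hv
  set u : ι → ℝ := fun i => s i * v i with hu
  have h1 i : s i * ∑ j, B i j * u j = c * v i := by
    rw [← hAv, hv]; rfl
  have hv0 i (hi : r i = 0) : v i = 0 := by
    have := h1 i
    rw [hs0 i hi, zero_mul] at this
    exact (mul_eq_zero.1 this.symm).resolve_left hc.ne'
  have hBu : ∑ i, u i * ∑ j, B i j * u j = c * ∑ i, v i ^ 2 := by
    rw [Finset.mul_sum]
    exact Finset.sum_congr rfl fun i _ => by rw [hu]; linear_combination v i * h1 i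
  have hle : c * ∑ i, v i ^ 2 ≤ c ^ 2 * ∑ i, v i ^ 2 := by
    rw [← hBu]
    refine (h u).trans_eq ?_
    rw [Finset.mul_sum]
    refine Finset.sum_congr rfl fun i _ => ?_
    rw [mul_div_right_comm, ← hs2, ← mul_pow, h1, mul_pow]
  have hV0 : 0 ≤ ∑ i, v i ^ 2 := Finset.sum_nonneg fun i _ => sq_nonneg _
  have hru i : r i * u i ^ 2 / w i = v i ^ 2 := by
    by_cases hi : r i = 0
    · simp [hi, hv0 i hi]
    · rw [mul_div_right_comm, ← hp2, hu]
      linear_combination (s i * p i + 1) * v i ^ 2 * hsp i hi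
  -- Perron-type bound: the left side is nonnegative, so c ≤ 1 unless v = 0. With `hle` both sides
  -- vanish, making u proportional to w on the support of r.
  have hperron : ∑ i, ∑ j, B i j * w i * w j * (u i / w i - u j / w j) ^ 2
      = 2 * (1 - c) * ∑ i, v i ^ 2 := by
    have e i j : B i j * w i * w j * (u i / w i - u j / w j) ^ 2
        = u i ^ 2 / w i * (B i j * w j) - 2 * (u i * (B i j * u j))
          + u j ^ 2 / w j * (B j i * w i) := by
      have := (hw i).ne'
      have := (hw j).ne'
      rw [hB j i]
      field_simp
      ring
    simp only [e, Finset.sum_add_distrib, Finset.sum_sub_distrib]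
    rw [Finset.sum_comm (f := fun i j => u j ^ 2 / w j * (B j i * w i))]
    simp only [← Finset.mul_sum, ← hr]
    rw [hBu]
    have : ∑ i, u i ^ 2 / w i * r i = ∑ i, v i ^ 2 :=
      Finset.sum_congr rfl fun i _ => by rw [← hru]; ring
    rw [this]
    ring
  have hterm : ∀ i j, 0 ≤ B i j * w i * w j * (u i / w i - u j / w j) ^ 2 := fun i j =>
    mul_nonneg (mul_nonneg (mul_nonneg (hB0 i j) (hw i).le) (hw j).le) (sq_nonneg _)
  have hsum0 : ∑ i, ∑ j, B i j * w i * w j * (u i / w i - u j / w j) ^ 2 = 0 := by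
    refine le_antisymm ?_ (Finset.sum_nonneg fun i _ => Finset.sum_nonneg fun j _ => hterm i j)
    rw [hperron]
    have : 0 ≤ c * ((c - 1) * ∑ i, v i ^ 2) := by linarith
    have := nonneg_of_mul_nonneg_right this hc
    linarith
  have hprop i (hi : r i ≠ 0) : u i = u o / w o * w i := by
    rw [Finset.sum_eq_zero_iff_of_nonneg
      fun i _ => Finset.sum_nonneg fun j _ => hterm i j] at hsum0
    have h2 := hsum0 o (Finset.mem_univ o)
    rw [Finset.sum_eq_zero_iff_of_nonneg fun j _ => hterm o j] at h2
    have h3 := h2 i (Finset.mem_univ i)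
    have h4 : u o / w o - u i / w i = 0 := by
      simpa [ho i hi, (hw i).ne', (hw o).ne'] using h3
    rw [sub_eq_zero.1 h4, div_mul_cancel₀ _ (hw i).ne']
  calc ∑ i, x i * p i * v i = ∑ i, u o / w o * (r i * x i) := by
        refine Finset.sum_congr rfl fun i _ => ?_
        by_cases hi : r i = 0
        · simp [hi, hp0 i hi]
        · have e1 : v i = p i * u i := by
            rw [hu]; linear_combination - v i * hsp i hi
          have e2 : p i ^ 2 * w i = r i := by rw [hp2, div_mul_cancel₀ _ (hw i).ne']
          rw [e1, hprop i hi]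
          linear_combination x i * (u o / w o) * e2
    _ = 0 := by rw [← Finset.mul_sum, hx, mul_zero]

end Form

/-! ### Weighted walks and the induction on their length -/

section LevelSum

variable {ι A : Type*} [Fintype ι] [AddCommMonoid A]

/-- The weighted sum of the values of `g` over all `n`-step walks from `m`, where the step `z`
adds `e z` and has weight `w z`. -/
noncomputable def levelSum (e : ι → A) (w : ι → ℝ) (g : A → ℝ) : ℕ → A → ℝ
  | 0, m => g m
  | n + 1, m => ∑ z, w z * levelSum e w g n (e z + m)

variable {e : ι → A} {w : ι → ℝ} {g : A → ℝ}

theorem levelSum_nonneg (hw : ∀ z, 0 ≤ w z) (hg : ∀ m, 0 ≤ g m) (n : ℕ) (m : A) :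
    0 ≤ levelSum e w g n m := by
  induction n generalizing m with
  | zero => exact hg m
  | succ n ih => exact Finset.sum_nonneg fun z _ => mul_nonneg (hw z) (ih _)

theorem levelSum_eq_zero (hg : ∀ z m, g m = 0 → g (e z + m) = 0) (n : ℕ) (m : A)
    (hm : g m = 0) : levelSum e w g n m = 0 := by
  induction n generalizing m with
  | zero => exact hm
  | succ n ih => exact Finset.sum_eq_zero fun z _ => by rw [ih _ (hg z m hm), mul_zero]

theorem levelSum_pos (hw : ∀ z, 0 < w z) (hg : ∀ m, 0 ≤ g m) {o : ι} (ho : e o = 0) (n : ℕ)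
    (m : A) (hm : g m ≠ 0) : 0 < levelSum e w g n m := by
  induction n generalizing m with
  | zero => exact lt_of_le_of_ne (hg m) hm.symm
  | succ n ih =>
    refine Finset.sum_pos' (fun z _ => mul_nonneg (hw z).le
      (levelSum_nonneg (fun z => (hw z).le) hg n _)) ⟨o, Finset.mem_univ o, ?_⟩
    rw [ho, zero_add]
    exact mul_pos (hw o) (ih m hm)

theorem levelSum_form_le_sq (hw : ∀ z, 0 < w z) (hg : ∀ m, 0 ≤ g m)
    (hg0 : ∀ z m, g m = 0 → g (e z + m) = 0) {o : ι} (ho : e o = 0)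
    (hbase : ∀ m (u : ι → ℝ), g m ≠ 0 → ∑ x, g (e x + m) * u x = 0 →
      ∑ x, u x * ∑ y, g (e y + (e x + m)) * u y ≤ 0) (n : ℕ) (m : A) (u : ι → ℝ) :
    (∑ x, u x * ∑ y, levelSum e w g n (e y + (e x + m)) * u y) * levelSum e w g (n + 2) m
      ≤ (∑ x, u x * levelSum e w g (n + 1) (e x + m)) ^ 2 := by
  have hw' z : 0 ≤ w z := (hw z).le
  have hsucc n m : ∑ z, levelSum e w g n (e z + m) * w z = levelSum e w g (n + 1) m :=
    Finset.sum_congr rfl fun z _ => mul_comm _ _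
  have hcomm (x y : ι) (m : A) : e x + (e y + m) = e y + (e x + m) := add_left_comm _ _ _
  have hsymm n m (x y : ι) : levelSum e w g n (e y + (e x + m))
      = levelSum e w g n (e x + (e y + m)) := by rw [hcomm]
  have reduce (n : ℕ) (m : A) (u l : ι → ℝ) (hl : ∑ i, l i * w i ≠ 0)
      (h : ∀ x : ι → ℝ, ∑ i, l i * x i = 0 →
        ∑ i, x i * ∑ j, levelSum e w g n (e j + (e i + m)) * x j ≤ 0) :
      (∑ x, u x * ∑ y, levelSum e w g n (e y + (e x + m)) * u y) * levelSum e w g (n + 2) m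
        ≤ (∑ x, u x * levelSum e w g (n + 1) (e x + m)) ^ 2 := by
    have hww : ∑ i, w i * ∑ j, levelSum e w g n (e j + (e i + m)) * w j
        = levelSum e w g (n + 2) m := by simp only [hsucc]; rfl
    have := reverse_cauchySchwarz_of_nonpos_on_hyperplane (hsymm n m) w l hl
      (hww ▸ levelSum_nonneg hw' hg _ _) h u
    rw [hww] at this
    simpa only [hsucc] using this
  induction n generalizing m u with
  | zero =>
    by_cases hm : g m = 0
    · rw [levelSum_eq_zero hg0 _ m hm, mul_zero]
      positivity
    refine reduce 0 m u (fun x => g (e x + m)) ?_ (fun x hx => hbase m x hm hx)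
    exact ((hsucc 0 m).trans_ne (levelSum_pos hw hg ho 1 m hm).ne')
  | succ n ih =>
    by_cases hm : g m = 0
    · rw [levelSum_eq_zero hg0 _ m hm, mul_zero]
      positivity
    refine reduce (n + 1) m u (fun x => levelSum e w g (n + 2) (e x + m))
      ((hsucc (n + 2) m).trans_ne (levelSum_pos hw hg ho _ m hm).ne') ?_
    refine form_nonpos_of_le_sum_sq_div (hsymm (n + 1) m)
      (fun i j => levelSum_nonneg hw' hg _ _) w _ hw (fun i => (hsucc (n + 1) (e i + m)).symm)
      o ?_ ?_
    · intro i hi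
      rw [ho, zero_add]
      refine (levelSum_pos hw hg ho _ _ fun h0 => hi ?_).ne'
      exact levelSum_eq_zero hg0 _ _ h0
    -- The form at level n + 1 is the w-average over the first step z of the level-n forms based at
    -- `e z + m`; the induction hypothesis bounds each of them.
    · intro v
      have hexp : ∑ i, v i * ∑ j, levelSum e w g (n + 1) (e j + (e i + m)) * v j
          = ∑ z, w z * ∑ i, v i * ∑ j, levelSum e w g n (e j + (e i + (e z + m))) * v j := by
        simp only [levelSum, Finset.sum_mul, Finset.mul_sum]
        rw [eq_comm, Finset.sum_comm]
        refine Finset.sum_congr rfl fun i _ => ?_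
        rw [Finset.sum_comm]
        refine Finset.sum_congr rfl fun j _ => Finset.sum_congr rfl fun z _ => ?_
        rw [hcomm i z, hcomm j z]
        ring
      rw [hexp]
      refine Finset.sum_le_sum fun z _ => ?_
      rw [mul_div_assoc]
      refine mul_le_mul_of_nonneg_left ?_ (hw' z)
      have key := ih (e z + m) v
      have hlin : ∑ x, v x * levelSum e w g (n + 1) (e x + (e z + m))
          = ∑ j, levelSum e w g (n + 1) (e j + (e z + m)) * v j :=
        Finset.sum_congr rfl fun x _ => mul_comm _ _
      rw [hlin] at key
      by_cases hz : g (e z + m) = 0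
      · have h0 i j : levelSum e w g n (e j + (e i + (e z + m))) = 0 :=
          levelSum_eq_zero hg0 _ _ (hg0 _ _ (hg0 _ _ hz))
        simp only [h0, zero_mul, Finset.sum_const_zero, mul_zero]
        exact div_nonneg (sq_nonneg _) (levelSum_nonneg hw' hg _ _)
      · rwa [le_div_iff₀ (levelSum_pos hw hg ho _ _ hz)]

/-- Test the form inequality on the unit vector at `o`, whose step does not move. -/
theorem levelSum_mul_le_sq (hw : ∀ z, 0 < w z) (hg : ∀ m, 0 ≤ g m)
    (hg0 : ∀ z m, g m = 0 → g (e z + m) = 0) {o : ι} (ho : e o = 0)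
    (hbase : ∀ m (u : ι → ℝ), g m ≠ 0 → ∑ x, g (e x + m) * u x = 0 →
      ∑ x, u x * ∑ y, g (e y + (e x + m)) * u y ≤ 0) (n : ℕ) (m : A) :
    levelSum e w g n m * levelSum e w g (n + 2) m ≤ levelSum e w g (n + 1) m ^ 2 := by
  classical
  simpa [Pi.single_apply, ho] using
    levelSum_form_le_sq hw hg hg0 ho hbase n m (Pi.single o 1)

end LevelSum

/-- Grouping by the fibres of `f` makes this a sum of squares. -/
theorem Finset.sum_sum_ite_eq_nonneg {β γ : Type*} [Fintype β] [DecidableEq γ] (f : β → γ)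
    (v : β → ℝ) : 0 ≤ ∑ i, ∑ j, if f i = f j then v i * v j else 0 := by
  have : ∑ i, ∑ j, (if f i = f j then v i * v j else 0)
      = ∑ c ∈ Finset.univ.image f, (∑ i, if f i = c then v i else 0) ^ 2 := by
    simp only [sq, Finset.sum_mul_sum]
    rw [Finset.sum_comm]
    rw [Finset.sum_comm (s := Finset.univ.image f), Finset.sum_comm]
    refine Finset.sum_congr rfl fun i _ => ?_
    rw [Finset.sum_comm]
    refine Finset.sum_congr rfl fun j _ => ?_
    rw [Finset.sum_eq_single_of_mem (f i) (Finset.mem_image_of_mem f (Finset.mem_univ i))]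
    · simp only [if_true, mul_ite, mul_zero, eq_comm]
    · intro c _ hc
      rw [if_neg hc.symm, zero_mul]
  rw [this]
  exact Finset.sum_nonneg fun c _ => sq_nonneg _

/-! ### The base case: independence in a matroid -/

namespace Matroid

variable {β : Type*}

open Classical in
/-- The indicator of the duplicate-free multisets whose elements form an independent set. -/
noncomputable def indepIndicator (M : Matroid β) (m : Multiset β) : ℝ :=
  if m.Nodup ∧ M.Indep {x | x ∈ m} then 1 else 0

/-- The step indexed by `Option β`: either add nothing or add one element. -/
def optionStep : Option β → Multiset β
  | none => 0
  | some i => {i}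

theorem indepIndicator_nonneg (M : Matroid β) (m : Multiset β) : 0 ≤ M.indepIndicator m := by
  unfold indepIndicator; split_ifs <;> norm_num

theorem setOf_mem_cons (i : β) (m : Multiset β) :
    {x | x ∈ i ::ₘ m} = insert i {x | x ∈ m} := by
  ext; simp

theorem indepIndicator_cons_eq_zero (M : Matroid β) (i : β) {m : Multiset β}
    (hm : M.indepIndicator m = 0) : M.indepIndicator (i ::ₘ m) = 0 := by
  classical
  rw [indepIndicator, ite_eq_right_iff] at hm ⊢
  intro h
  rw [Multiset.nodup_cons, setOf_mem_cons] at h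
  exact hm ⟨h.1.2, h.2.subset (Set.subset_insert _ _)⟩

theorem indepIndicator_optionStep_add_eq_zero (M : Matroid β) (z : Option β) (m : Multiset β)
    (hm : M.indepIndicator m = 0) : M.indepIndicator (optionStep z + m) = 0 := by
  cases z with
  | none => simpa [optionStep] using hm
  | some i => exact M.indepIndicator_cons_eq_zero i hm

-- Two independent one-element extensions of a set fail to combine exactly when they span the same
-- flat, by closure exchange; i = j is included.
open Classical in
theorem indepIndicator_cons_cons (M : Matroid β) {m : Multiset β} (i j : β) :
    M.indepIndicator (j ::ₘ i ::ₘ m) = M.indepIndicator (i ::ₘ m) * M.indepIndicator (j ::ₘ m)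
      - if M.closure (insert i {x | x ∈ m}) = M.closure (insert j {x | x ∈ m}) then
        M.indepIndicator (i ::ₘ m) * M.indepIndicator (j ::ₘ m) else 0 := by
  by_cases hi : M.indepIndicator (i ::ₘ m) = 0
  · simp [hi, M.indepIndicator_cons_eq_zero j hi]
  by_cases hj : M.indepIndicator (j ::ₘ m) = 0
  · rw [Multiset.cons_swap]
    simp [hj, M.indepIndicator_cons_eq_zero i hj]
  simp only [indepIndicator, ite_eq_right_iff, one_ne_zero, imp_false, not_not] at hi hj
  have hi1 : M.indepIndicator (i ::ₘ m) = 1 := if_pos hi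
  have hj1 : M.indepIndicator (j ::ₘ m) = 1 := if_pos hj
  rw [hi1, hj1, indepIndicator]
  simp only [setOf_mem_cons, Multiset.nodup_cons] at hi hj ⊢
  set S : Set β := {x | x ∈ m}
  have hjE : j ∈ M.E := hj.2.subset_ground (Set.mem_insert j S)
  have hjS : j ∉ M.closure S :=
    ((hj.2.subset (Set.subset_insert j S)).notMem_closure_iff_of_notMem hj.1.1).2 hj.2
  by_cases hf : M.closure (insert i S) = M.closure (insert j S)
  · rw [if_neg, if_pos hf]
    · norm_num
    rintro ⟨⟨hji, -⟩, hind⟩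
    have hmem : j ∈ M.closure (insert i S) :=
      hf ▸ M.mem_closure_of_mem (Set.mem_insert j S) hj.2.subset_ground
    rw [hi.2.mem_closure_iff_of_notMem] at hmem
    · exact hmem.not_indep hind
    · simpa [S] using hji
  · rw [if_pos, if_neg hf]
    · norm_num
    have hmem : j ∉ M.closure (insert i S) := fun hmem =>
      hf (M.closure_insert_congr ⟨hmem, hjS⟩).symm
    have hji : j ∉ insert i S := fun h => hmem (M.mem_closure_of_mem h hi.2.subset_ground)
    exact ⟨⟨by simpa [S] using hji, hi.1⟩, (hi.2.notMem_closure_iff_of_notMem hji).1 hmem⟩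

/-- The form is (`u none` + L)² minus a sum of squares over flats, and the hyperplane is `u none` +
L = 0. -/
theorem indepIndicator_form_nonpos [Fintype β] (M : Matroid β) (m : Multiset β) (u : Option β → ℝ)
    (hm : M.indepIndicator m ≠ 0) (hu : ∑ x, M.indepIndicator (optionStep x + m) * u x = 0) :
    ∑ x, u x * ∑ y, M.indepIndicator (optionStep y + (optionStep x + m)) * u y ≤ 0 := by
  classical
  have hm1 : M.indepIndicator m = 1 := by
    rw [indepIndicator, if_pos (of_not_not fun h => hm (if_neg h))]
  have hnn := Finset.sum_sum_ite_eq_nonneg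
    (fun i => M.closure (insert i {x | x ∈ m})) (fun i => M.indepIndicator (i ::ₘ m) * u (some i))
  simp only [Fintype.sum_option, optionStep, zero_add, hm1, Multiset.singleton_add,
    indepIndicator_cons_cons, sub_mul, Finset.sum_sub_distrib] at hu ⊢
  set L := ∑ i, M.indepIndicator (i ::ₘ m) * u (some i)
  have h1 : ∑ i, u (some i) * (M.indepIndicator (i ::ₘ m) * u none +
      (∑ j, M.indepIndicator (i ::ₘ m) * M.indepIndicator (j ::ₘ m) * u (some j) -
        ∑ j, (if M.closure (insert i {x | x ∈ m}) = M.closure (insert j {x | x ∈ m}) then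
          M.indepIndicator (i ::ₘ m) * M.indepIndicator (j ::ₘ m) else 0) * u (some j)))
      = L * u none + L * L - ∑ i, ∑ j, if M.closure (insert i {x | x ∈ m}) =
        M.closure (insert j {x | x ∈ m}) then (M.indepIndicator (i ::ₘ m) * u (some i)) *
          (M.indepIndicator (j ::ₘ m) * u (some j)) else 0 := by
    rw [Finset.sum_mul, Finset.sum_mul, ← Finset.sum_add_distrib, ← Finset.sum_sub_distrib]
    refine Finset.sum_congr rfl fun i _ => ?_
    rw [mul_add, mul_sub, ← add_sub_assoc, Finset.mul_sum, Finset.mul_sum, Finset.mul_sum]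
    congr 1
    · congr 1
      · ring
      · exact Finset.sum_congr rfl fun j _ => by ring
    · refine Finset.sum_congr rfl fun j _ => ?_
      split_ifs
      · ring
      · ring
  rw [h1]
  nlinarith [sq_nonneg (u none + L)]

end Matroid

/-! ### Counting independent sets and the limit t → 0 -/

namespace Matroid

variable {β : Type*} [Fintype β]

open Classical in
/-- The independent sets of size `S.card + n` containing `S`. -/
noncomputable def indepExtensions (M : Matroid β) (S : Finset β) (n : ℕ) : Finset (Finset β) :=
  {I | S ⊆ I ∧ I.card = S.card + n ∧ M.Indep I}

theorem mem_indepExtensions (M : Matroid β) {S : Finset β} {n : ℕ} {I : Finset β} :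
    I ∈ M.indepExtensions S n ↔ S ⊆ I ∧ I.card = S.card + n ∧ M.Indep I := by
  simp [indepExtensions]

/-- Double count pairs (i, I) with i in I \ S. -/
theorem sum_card_indepExtensions_insert [DecidableEq β] (M : Matroid β) (S : Finset β) (n : ℕ) :
    ∑ i ∈ Sᶜ, (M.indepExtensions (insert i S) n).card
      = (n + 1) * (M.indepExtensions S (n + 1)).card := by
  have h1 : ∀ i ∈ Sᶜ, M.indepExtensions (insert i S) n
      = Finset.bipartiteAbove (fun i I => i ∈ I) (M.indepExtensions S (n + 1)) i := by
    intro i hi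
    rw [Finset.mem_compl] at hi
    ext I
    simp only [Finset.mem_bipartiteAbove, mem_indepExtensions, Finset.insert_subset_iff,
      Finset.card_insert_of_notMem hi, add_assoc, add_comm n 1]
    tauto
  have h2 : ∀ I ∈ M.indepExtensions S (n + 1),
      (Finset.bipartiteBelow (fun i I => i ∈ I) Sᶜ I).card = n + 1 := by
    intro I hI
    rw [mem_indepExtensions] at hI
    have : Finset.bipartiteBelow (fun i I => i ∈ I) Sᶜ I = I \ S := by
      ext; simp [Finset.mem_bipartiteBelow, and_comm]
    rw [this, Finset.card_sdiff_of_subset hI.1, hI.2.1, Nat.add_sub_cancel_left]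
  rw [Finset.sum_congr rfl fun i hi => congrArg Finset.card (h1 i hi),
    Finset.sum_card_bipartiteAbove_eq_sum_card_bipartiteBelow, Finset.sum_congr rfl h2,
    Finset.sum_const, smul_eq_mul, mul_comm]

/-- At t = 0 every step adds an element, and each extension is reached in n! orders. -/
theorem levelSum_indepIndicator [DecidableEq β] (M : Matroid β) (n : ℕ) (m : Multiset β) :
    levelSum optionStep (fun z => z.elim 0 fun _ => 1) M.indepIndicator n m
      = if m.Nodup then (n.factorial * (M.indepExtensions m.toFinset n).card : ℝ) else 0 := by
  induction n generalizing m with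
  | zero =>
    by_cases hm : m.Nodup
    · by_cases hI : M.Indep {x | x ∈ m}
      · have : M.indepExtensions m.toFinset 0 = {m.toFinset} := by
          ext I
          rw [mem_indepExtensions, Finset.mem_singleton]
          refine ⟨fun h => (Finset.eq_of_subset_of_card_le h.1 h.2.1.le).symm, ?_⟩
          rintro rfl
          exact ⟨subset_rfl, rfl, hI.subset fun x hx => Multiset.mem_toFinset.1 hx⟩
        simp [levelSum, indepIndicator, hm, hI, this]
      · have : M.indepExtensions m.toFinset 0 = ∅ := by
          refine Finset.eq_empty_of_forall_notMem fun I hI' => hI ?_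
          rw [mem_indepExtensions] at hI'
          exact hI'.2.2.subset fun x hx => hI'.1 (Multiset.mem_toFinset.2 hx)
        simp [levelSum, indepIndicator, hI, this]
    · simp [levelSum, indepIndicator, hm]
  | succ n ih =>
    simp only [levelSum, Fintype.sum_option, Option.elim_none, Option.elim_some, zero_mul,
      zero_add, one_mul, optionStep, ih, Multiset.singleton_add, Multiset.nodup_cons, Multiset.toFinset_cons]
    by_cases hm : m.Nodup
    · simp only [hm, and_true, if_true]
      rw [← Finset.sum_filter]
      have : (Finset.univ.filter fun i => i ∉ m) = (m.toFinset)ᶜ := by ext; simp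
      rw [this, ← Finset.mul_sum]
      have key := M.sum_card_indepExtensions_insert m.toFinset n
      rw [← Nat.cast_sum, key, Nat.factorial_succ]
      push_cast
      ring
    · simp [hm]

theorem continuous_levelSum_indepIndicator (M : Matroid β) (n : ℕ) (m : Multiset β) :
    Continuous fun t : ℝ =>
      levelSum optionStep (fun z => z.elim t fun _ => 1) M.indepIndicator n m := by
  induction n generalizing m with
  | zero => exact continuous_const
  | succ n ih =>
    refine continuous_finsetSum _ fun z _ => Continuous.mul ?_ (ih _)
    cases z with
    | none => exact continuous_id
    | some i => exact continuous_const

theorem card_indepExtensions_empty_mul_le_sq (M : Matroid β) (k : ℕ) :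
    ((M.indepExtensions ∅ k).card * (M.indepExtensions ∅ (k + 2)).card : ℝ)
      ≤ (M.indepExtensions ∅ (k + 1)).card ^ 2 := by
  classical
  have hpos : ∀ t ∈ Set.Ioi (0 : ℝ),
      levelSum optionStep (fun z => z.elim t fun _ => 1) M.indepIndicator k 0 *
        levelSum optionStep (fun z => z.elim t fun _ => 1) M.indepIndicator (k + 2) 0
      ≤ levelSum optionStep (fun z => z.elim t fun _ => 1) M.indepIndicator (k + 1) 0 ^ 2 := by
    intro t ht
    refine levelSum_mul_le_sq ?_ M.indepIndicator_nonneg M.indepIndicator_optionStep_add_eq_zero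
      (o := none) rfl M.indepIndicator_form_nonpos k 0
    rintro (_ | i)
    · exact ht
    · exact one_pos
  -- The spectral argument needs t > 0; the inequality extends to t = 0 by continuity.
  have h0 := (isClosed_le
    ((M.continuous_levelSum_indepIndicator k 0).mul (M.continuous_levelSum_indepIndicator (k + 2) 0))
    ((M.continuous_levelSum_indepIndicator (k + 1) 0).pow 2)).closure_subset_iff.2 hpos
    ((closure_Ioi (0 : ℝ)).symm ▸ Set.mem_Ici.2 le_rfl)
  simp only [Set.mem_ofPred_eq, Pi.mul_apply, Pi.pow_apply, levelSum_indepIndicator, Multiset.nodup_zero, if_true,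
    Multiset.toFinset_zero, Nat.factorial_succ] at h0
  push_cast at h0
  set a : ℝ := ((M.indepExtensions ∅ k).card : ℝ)
  set b : ℝ := ((M.indepExtensions ∅ (k + 1)).card : ℝ)
  set c : ℝ := ((M.indepExtensions ∅ (k + 2)).card : ℝ)
  have hf : (0 : ℝ) < (k.factorial : ℝ) ^ 2 * (k + 1) := by positivity
  have hac : 0 ≤ a * c := by positivity
  have h1 : (k.factorial : ℝ) ^ 2 * (k + 1) * ((k + 2) * (a * c))
      ≤ (k.factorial : ℝ) ^ 2 * (k + 1) * ((k + 1) * b ^ 2) := by linarith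
  have h2 := le_of_mul_le_mul_left h1 hf
  have hk : (0 : ℝ) < k + 1 := by positivity
  exact le_of_mul_le_mul_left (by linarith) hk

theorem numIndep_eq_card_indepExtensions {α : Type*} (M : Matroid α) [Fintype M.E] (k : ℕ) :
    M.numIndep k = ((M.restrictSubtype M.E).indepExtensions ∅ k).card := by
  have hinj : Function.Injective fun I : Finset M.E => Subtype.val '' (I : Set M.E) :=
    (Set.image_injective.2 Subtype.val_injective).comp Finset.coe_injective
  rw [numIndep, ← Set.ncard_coe_finset, ← Set.ncard_image_of_injective _ hinj]
  congr 1
  ext I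
  simp only [Set.mem_ofPred_eq, Set.mem_image, Finset.mem_coe, mem_indepExtensions,
    Finset.empty_subset, true_and, Finset.card_empty, zero_add, restrictSubtype_indep_iff]
  constructor
  · rintro ⟨hI, hk⟩
    classical
    have hval : Subtype.val '' (((↑) : M.E → α) ⁻¹' I) = I := by
      rw [Subtype.image_preimage_coe, Set.inter_eq_right.2 hI.subset_ground]
    refine ⟨(((↑) : M.E → α) ⁻¹' I).toFinset, ⟨?_, ?_⟩, ?_⟩
    · rw [← Set.ncard_eq_toFinset_card', ← Set.ncard_image_of_injective _ Subtype.val_injective,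
        hval, hk]
    · rwa [Set.coe_toFinset, hval]
    · rw [Set.coe_toFinset, hval]
  · rintro ⟨J, ⟨hk, hJ⟩, rfl⟩
    exact ⟨hJ, by rw [Set.ncard_image_of_injective _ Subtype.val_injective, Set.ncard_coe_finset, hk]⟩

theorem indepExtensions_empty_nonempty_of_le (M : Matroid β) {k j : ℕ} (hkj : k ≤ j)
    (hj : (M.indepExtensions ∅ j).Nonempty) : (M.indepExtensions ∅ k).Nonempty := by
  obtain ⟨I, hI⟩ := hj
  rw [mem_indepExtensions, Finset.card_empty, zero_add] at hI
  obtain ⟨J, hJI, hJ⟩ := Finset.exists_subset_card_eq (hI.2.1.symm ▸ hkj)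
  exact ⟨J, M.mem_indepExtensions.2 ⟨J.empty_subset, by simpa using hJ, hI.2.2.subset (by simpa)⟩⟩

end Matroid

theorem mainTheorem3 {α : Type*} (M : Matroid α) [M.Finite] :
    IsLogConcaveSeq (fun k : ℕ => (M.numIndep k : ℝ)) := by
  have := M.ground_finite.fintype
  simp only [M.numIndep_eq_card_indepExtensions]
  refine ⟨fun k => Nat.cast_nonneg _, fun i j k _ hkj _ hj => ?_,
    fun k => Matroid.card_indepExtensions_empty_mul_le_sq _ k⟩
  rw [Nat.cast_ne_zero, Finset.card_ne_zero] at hj ⊢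
  exact Matroid.indepExtensions_empty_nonempty_of_le _ hkj.le hj
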